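/- For integers $m,n\ge 1$ and $A\in\mathbb R^{m\times n}$ let $\|A\|_{1\to\infty}=\max_{i,j}|a_{i,j}|$ be the operator norm from $\ell_1^n$ to $\ell_\infty^m$. For $C>0$ let $$\Gamma_{A,C}=\{x\in\mathbb R^n:\ \|Ax\|_\infty\le C\sqrt{n\log(m/n+2)}\ \text{ and }\ \|x\|_\infty\le 1\},\qquad \mathrm{OPT}_A(C)=\frac{1}{\sqrt n}\,\mathbb E_{g\sim\mathcal N(0,I_n)}\Big[\max_{y\in\Gamma_{A,C}}\langle g,y\rangle\Big].$$ There exist an absolute constant $c>0$ and a non-increasing function $C_0:(0,1]\to\mathbb R^{>0}$ such that the following holds for all $m,n$ and all $A\in\mathbb R^{m\times n}$ with $\|A\|_{1\to\infty}\le 1$. For every $0\le\epsilon\le c$, every $\delta\in(0,1]$ and every $C\ge C_0(\delta)$, $$\mathbb P_{C'\sim\mathrm{Unif}[C,2C]}\big[\mathrm{OPT}_A(C'+C\epsilon)-\mathrm{OPT}_A(C')\le\delta\,\epsilon\sqrt n\big]\ \ge\ \frac56 .$$ -/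

import Mathlib

open MeasureTheory ProbabilityTheory

noncomputable section

namespace SpencerLP

/-- The operator norm `‖A‖_{1→∞}` of `A` as a map from `(ℝⁿ, ‖·‖₁)` to `(ℝᵐ, ‖·‖_∞)`.
The norm on `Fin m → ℝ` is the supremum norm. -/
def oneToInftyNorm {m n : ℕ} (A : Matrix (Fin m) (Fin n) ℝ) : ℝ :=
  sSup ((fun x : Fin n → ℝ => ‖A.mulVec x‖) '' {x | ∑ j, |x j| ≤ 1})

/-- The polytope `Γ_{A,C} = {x ∈ ℝⁿ : ‖Ax‖_∞ ≤ C √(n log(m/n + 2)) and ‖x‖_∞ ≤ 1}`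
(norms on `Fin k → ℝ` are supremum norms). -/
def Gam {m n : ℕ} (A : Matrix (Fin m) (Fin n) ℝ) (C : ℝ) : Set (Fin n → ℝ) :=
  {x | ‖A.mulVec x‖ ≤ C * √((n : ℝ) * Real.log ((m : ℝ) / (n : ℝ) + 2)) ∧ ‖x‖ ≤ 1}

/-- The optimum `max_{y ∈ Γ_{A,C}} ⟨g, y⟩` of the linear program with objective `g`. -/
def lpValue {m n : ℕ} (A : Matrix (Fin m) (Fin n) ℝ) (C : ℝ) (g : Fin n → ℝ) : ℝ :=
  sSup ((fun y : Fin n → ℝ => g ⬝ᵥ y) '' Gam A C)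

/-- The standard Gaussian law `N(0, I_n) = N(0,1)^{⊗ n}` on `ℝⁿ`. -/
def stdNormal (n : ℕ) : Measure (Fin n → ℝ) :=
  Measure.pi fun _ : Fin n => gaussianReal 0 1

/-- `OPT_A(C) = E_{g ∼ N(0, I_n)} [max_{y ∈ Γ_{A,C}} ⟨g, y⟩] / √n`. -/
def OPT {m n : ℕ} (A : Matrix (Fin m) (Fin n) ℝ) (C : ℝ) : ℝ :=
  (∫ g, lpValue A C g ∂(stdNormal n)) / √(n : ℝ)

/-- The uniform probability measure on the interval `[a, b]`. -/
def unif (a b : ℝ) : Measure ℝ := ProbabilityTheory.cond volume (Set.Icc a b)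

/-! Sanity facts: the norm is the largest absolute value of an entry, the maximum is attained,
its expectation is that of an integrable function, and the uniform law is a probability. -/

theorem oneToInftyNorm_le_one_iff {m n : ℕ} (A : Matrix (Fin m) (Fin n) ℝ) :
    oneToInftyNorm A ≤ 1 ↔ ∀ i j, |A i j| ≤ 1 := by
  have key : ∀ K : ℝ, (∀ i j, |A i j| ≤ K) → 0 ≤ K → ∀ x : Fin n → ℝ, ∑ j, |x j| ≤ 1 →
      ‖A.mulVec x‖ ≤ K := by
    intro K hK hK0 x hx
    refine (pi_norm_le_iff_of_nonneg hK0).2 fun i => ?_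
    calc ‖A.mulVec x i‖ = |∑ j, A i j * x j| := rfl
      _ ≤ ∑ j, |A i j * x j| := Finset.abs_sum_le_sum_abs _ _
      _ ≤ ∑ j, K * |x j| := Finset.sum_le_sum fun j _ => by
          rw [abs_mul]; exact mul_le_mul_of_nonneg_right (hK i j) (abs_nonneg _)
      _ = K * ∑ j, |x j| := by rw [Finset.mul_sum]
      _ ≤ K := mul_le_of_le_one_right hK0 hx
  constructor
  · intro h i j
    have hb : BddAbove ((fun x : Fin n → ℝ => ‖A.mulVec x‖) '' {x | ∑ j, |x j| ≤ 1}) := by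
      refine ⟨∑ i, ∑ j, |A i j|, ?_⟩
      rintro _ ⟨x, hx, rfl⟩
      refine key _ (fun i j => ?_) (by positivity) x hx
      calc |A i j| ≤ ∑ j, |A i j| :=
            Finset.single_le_sum (f := fun j => |A i j|) (fun _ _ => abs_nonneg _)
              (Finset.mem_univ j)
        _ ≤ ∑ i, ∑ j, |A i j| :=
            Finset.single_le_sum (f := fun i => ∑ j, |A i j|)
              (fun _ _ => Finset.sum_nonneg fun _ _ => abs_nonneg _) (Finset.mem_univ i)
    have h1 : ‖A.mulVec (Pi.single j 1)‖ ≤ 1 := by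
      refine le_trans (le_csSup hb ⟨Pi.single j 1, ?_, rfl⟩) h
      simp [Pi.single_apply, apply_ite abs]
    have h2 := norm_le_pi_norm (A.mulVec (Pi.single j 1)) i
    simp only [Matrix.mulVec_single_one, Matrix.col_apply, Real.norm_eq_abs] at h2 h1
    exact h2.trans h1
  · intro h
    refine csSup_le ⟨_, 0, by simp, rfl⟩ ?_
    rintro _ ⟨x, hx, rfl⟩
    exact key 1 h zero_le_one x hx

theorem isCompact_Gam {m n : ℕ} (A : Matrix (Fin m) (Fin n) ℝ) (C : ℝ) :
    IsCompact (Gam A C) := by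
  have hc : Continuous fun x : Fin n → ℝ => A.mulVec x :=
    Continuous.matrix_mulVec continuous_const continuous_id
  refine (isCompact_closedBall (0 : Fin n → ℝ) 1).of_isClosed_subset ?_ ?_
  · exact (isClosed_le hc.norm continuous_const).inter
      (isClosed_le continuous_norm continuous_const)
  · intro x hx
    simpa using hx.2

theorem zero_mem_Gam {m n : ℕ} (A : Matrix (Fin m) (Fin n) ℝ) {C : ℝ} (hC : 0 ≤ C) :
    (0 : Fin n → ℝ) ∈ Gam A C := by
  refine ⟨?_, by simp⟩
  simp only [Matrix.mulVec_zero, norm_zero]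
  positivity

theorem isGreatest_lpValue {m n : ℕ} (A : Matrix (Fin m) (Fin n) ℝ) {C : ℝ} (hC : 0 ≤ C)
    (g : Fin n → ℝ) :
    IsGreatest ((fun y : Fin n → ℝ => g ⬝ᵥ y) '' Gam A C) (lpValue A C g) := by
  have hc : Continuous fun y : Fin n → ℝ => g ⬝ᵥ y :=
    Continuous.dotProduct continuous_const continuous_id
  exact ((isCompact_Gam A C).image hc).isGreatest_sSup
    (Set.Nonempty.image _ ⟨0, zero_mem_Gam A hC⟩)

theorem dotProduct_le_of_norm_le_one {n : ℕ} (g y : Fin n → ℝ) (hy : ‖y‖ ≤ 1) :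
    g ⬝ᵥ y ≤ ∑ j, |g j| := by
  refine Finset.sum_le_sum fun j _ => ?_
  have h1 : |y j| ≤ 1 := (norm_le_pi_norm y j).trans hy
  calc g j * y j ≤ |g j * y j| := le_abs_self _
    _ = |g j| * |y j| := abs_mul _ _
    _ ≤ |g j| := mul_le_of_le_one_right (abs_nonneg _) h1

theorem integrable_lpValue {m n : ℕ} (A : Matrix (Fin m) (Fin n) ℝ) {C : ℝ} (hC : 0 ≤ C) :
    Integrable (lpValue A C) (stdNormal n) := by
  have hsub : ∀ g h : Fin n → ℝ, lpValue A C g - lpValue A C h ≤ ∑ j, |g j - h j| := by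
    intro g h
    obtain ⟨y, hy, hyg⟩ := (isGreatest_lpValue A hC g).1
    have h1 := (isGreatest_lpValue A hC h).2 ⟨y, hy, rfl⟩
    have h2 := dotProduct_le_of_norm_le_one (g - h) y hy.2
    simp only [sub_dotProduct, Pi.sub_apply] at h2 h1 hyg
    linarith
  have hcont : Continuous (lpValue A C) := by
    refine continuous_iff_continuousAt.2 fun h => ?_
    refine tendsto_iff_dist_tendsto_zero.2 ?_
    have hlim : Filter.Tendsto (fun g : Fin n → ℝ => ∑ j, |g j - h j|) (nhds h) (nhds 0) := by
      have hc : Continuous fun g : Fin n → ℝ => ∑ j, |g j - h j| := by fun_prop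
      simpa using hc.tendsto h
    refine squeeze_zero (fun _ => dist_nonneg) (fun g => ?_) hlim
    rw [Real.dist_eq, abs_le]
    have h1 := hsub g h
    have h2 := hsub h g
    simp only [abs_sub_comm (h _) (g _)] at h2
    constructor <;> linarith
  have hint : Integrable (fun g : Fin n → ℝ => ∑ j, |g j|) (stdNormal n) := by
    refine integrable_finsetSum _ fun j _ => ?_
    have h0 : Integrable (fun x : ℝ => |x|) (gaussianReal 0 1) :=
      ((memLp_id_gaussianReal (μ := 0) (v := 1) 1).integrable le_rfl).abs
    exact integrable_comp_eval (μ := fun _ : Fin n => gaussianReal 0 1) (i := j) h0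
  refine hint.mono' hcont.aestronglyMeasurable (Filter.Eventually.of_forall fun g => ?_)
  have h0 : 0 ≤ lpValue A C g := by
    simpa using (isGreatest_lpValue A hC g).2 ⟨0, zero_mem_Gam A hC, rfl⟩
  obtain ⟨y, hy, hyg⟩ := (isGreatest_lpValue A hC g).1
  rw [Real.norm_eq_abs, abs_of_nonneg h0, ← hyg]
  exact dotProduct_le_of_norm_le_one g y hy.2

theorem isProbabilityMeasure_unif {a b : ℝ} (hab : a < b) : IsProbabilityMeasure (unif a b) :=
  ProbabilityTheory.cond_isProbabilityMeasure_of_finite (by simp [hab]) (by simp)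

end SpencerLP

end

namespace SpencerLP

/-! ### Linear programming duality -/

/-! The estimate holds for every `C' ≥ C`, so the probability is 1. `OPT A` is concave in `C`
(`concaveOn_OPT`) and bounded by `E‖g‖₁ / √n`, the value for the whole cube. If `OPT A (C / 2)` is
already within `δ√n / 2` of this ceiling, the chord from `C / 2` to `C'` has slope at most `δ√n /
C`, and concavity passes this bound on to `[C', C' + Cε]`.

The work lies in the gap `E[‖g‖₁ - lpValue] ≤ 3δn`. With `R = C√(n log(m/n + 2))`, duality writes
the optimum as the infimum over `u` of `‖g - Aᵀu‖₁ + R‖u‖₁`. Rounding restricts `u` to the lattice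
`ηℤᵐ`, `η = δR/n`, at the cost of half the penalty and `δn/2`. The supremum over lattice points is
then bounded by a sum of exponentials: each shift `w` satisfies `E exp(δ(‖g‖₁ - ‖g - w‖₁)) ≤
exp(nδ²/2)`, while the penalty supplies weights `q^|zᵢ|` whose total is at most `exp(4mq) ≤
exp(nδ²)`. Jensen's inequality finishes. -/

theorem exists_dotProduct_eq_sum_abs {k : ℕ} (w : Fin k → ℝ) :
    ∃ y : Fin k → ℝ, ‖y‖ ≤ 1 ∧ w ⬝ᵥ y = ∑ j, |w j| := by
  refine ⟨fun j => SignType.sign (w j), (pi_norm_le_iff_of_nonneg zero_le_one).2 fun j => ?_, ?_⟩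
  · rcases lt_trichotomy (w j) 0 with h | h | h <;> simp [h]
  · exact Finset.sum_congr rfl fun j _ => self_mul_sign (w j)

/-- Hahn–Banach separates the image of the cube under `y ↦ (Ay, ⟨g, y⟩)` from `{‖·‖ ≤ R} × [V, ∞)`;
the normalized functional is the dual solution. The strict inequality on `V` makes the two sets
disjoint. -/
theorem exists_dual_le {m n : ℕ} (A : Matrix (Fin m) (Fin n) ℝ) {C : ℝ} (hC : 0 ≤ C)
    (g : Fin n → ℝ) {V : ℝ} (hV : lpValue A C g < V) :
    ∃ u : Fin m → ℝ, ∑ j, |g j - Matrix.vecMul u A j| +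
      C * √((n : ℝ) * Real.log ((m : ℝ) / (n : ℝ) + 2)) * ∑ i, |u i| ≤ V := by
  set R : ℝ := C * √((n : ℝ) * Real.log ((m : ℝ) / (n : ℝ) + 2)) with hR
  have hR0 : 0 ≤ R := by positivity
  have hlp0 : 0 ≤ lpValue A C g := by
    simpa using (isGreatest_lpValue A hC g).2 ⟨0, zero_mem_Gam A hC, rfl⟩
  have hV0 : 0 < V := hlp0.trans_lt hV
  let L : (Fin n → ℝ) →ₗ[ℝ] (Fin m → ℝ) × ℝ :=
    (Matrix.mulVecLin A).prod (dotProductBilin ℝ ℝ g)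
  have hL : ∀ y, L y = (A.mulVec y, g ⬝ᵥ y) := fun y => rfl
  have hLc : Continuous L := L.continuous_of_finiteDimensional
  let K : Set ((Fin m → ℝ) × ℝ) := L '' Metric.closedBall 0 1
  let T : Set ((Fin m → ℝ) × ℝ) := Metric.closedBall 0 R ×ˢ Set.Ici V
  have hK1 : Convex ℝ K := (convex_closedBall _ _).linear_image L
  have hK2 : IsCompact K := (isCompact_closedBall _ _).image hLc
  have hT1 : Convex ℝ T := (convex_closedBall _ _).prod (convex_Ici V)
  have hT2 : IsClosed T := Metric.isClosed_closedBall.prod isClosed_Ici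
  have hdisj : Disjoint K T := by
    rw [Set.disjoint_left]
    rintro _ ⟨y, hy, rfl⟩ ⟨h1, h2⟩
    rw [hL] at h1 h2
    simp only [Metric.mem_closedBall, dist_zero_right, Set.mem_Ici] at hy h1 h2
    have := (isGreatest_lpValue A hC g).2 ⟨y, ⟨h1, hy⟩, rfl⟩
    simp only at this
    linarith
  obtain ⟨f, s, t, hs, hst, ht⟩ := geometric_hahn_banach_compact_closed hK1 hK2 hT1 hT2 hdisj
  set τ : ℝ := f (0, 1) with hτ
  let w : Fin m → ℝ := fun i => f (Pi.single i 1, 0)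
  have hf : ∀ z r, f (z, r) = w ⬝ᵥ z + τ * r := by
    intro z r
    have h1 : ((z, r) : (Fin m → ℝ) × ℝ)
        = ∑ i, z i • ((Pi.single i 1 : Fin m → ℝ), (0 : ℝ)) + r • ((0 : Fin m → ℝ), (1 : ℝ)) := by
      refine Prod.ext ?_ ?_
      · simp only [Prod.fst_add, Prod.fst_sum, Prod.smul_fst, smul_zero, add_zero]
        exact pi_eq_sum_univ' z |>.trans (Finset.sum_congr rfl fun i _ => by
          ext j; simp [Pi.single_apply, eq_comm])
      · simp [Prod.snd_sum]
    rw [h1, map_add, map_sum]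
    simp only [map_smul, smul_eq_mul, dotProduct, ← hτ, w]
    congr 1
    · exact Finset.sum_congr rfl fun i _ => mul_comm _ _
    · ring
  have hs0 : 0 < s := by
    have := hs 0 ⟨0, by simp, map_zero L⟩
    simpa using this
  have hτ0 : 0 < τ := by
    have := ht (0, V) ⟨by simpa using hR0, by simp⟩
    rw [hf] at this
    simp only [dotProduct_zero, zero_add] at this
    by_contra h
    nlinarith
  refine ⟨fun i => - w i / τ, ?_⟩
  -- The separation is tested at the extremal points of the two sets, where the functional yields
  -- the two `ℓ₁` norms.
  obtain ⟨y, hy, hyv⟩ := exists_dotProduct_eq_sum_abs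
    (fun j => g j - Matrix.vecMul (fun i => - w i / τ) A j)
  obtain ⟨z, hz, hzv⟩ := exists_dotProduct_eq_sum_abs (fun i => - w i / τ)
  have h1 := hs (L y) ⟨y, by simpa using hy, rfl⟩
  have h2 := ht (R • z, V) ⟨by
    simp only [Metric.mem_closedBall, dist_zero_right, norm_smul, Real.norm_eq_abs,
      abs_of_nonneg hR0]
    nlinarith, by simp⟩
  rw [hL, hf] at h1
  rw [hf] at h2
  rw [← hyv, ← hzv]
  have e0 : (fun i => - w i / τ) = (-τ⁻¹) • w := by
    ext i; simp only [Pi.smul_apply, smul_eq_mul]; field_simp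
  have e1 : (fun j => g j - Matrix.vecMul (fun i => - w i / τ) A j) ⬝ᵥ y
      = g ⬝ᵥ y + τ⁻¹ * (w ⬝ᵥ A.mulVec y) := by
    change (g - Matrix.vecMul (fun i => - w i / τ) A) ⬝ᵥ y = _
    rw [sub_dotProduct, ← Matrix.dotProduct_mulVec, e0, smul_dotProduct, smul_eq_mul]
    ring
  rw [e1, e0, smul_dotProduct, smul_eq_mul]
  rw [dotProduct_smul, smul_eq_mul] at h2
  have h3 : w ⬝ᵥ A.mulVec y + τ * (g ⬝ᵥ y) ≤ R * (w ⬝ᵥ z) + τ * V := by linarith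
  have h4 := mul_le_mul_of_nonneg_left h3 (inv_pos.2 hτ0).le
  have e2 : τ⁻¹ * (τ * (g ⬝ᵥ y)) = g ⬝ᵥ y := by field_simp
  have e3 : τ⁻¹ * (τ * V) = V := by field_simp
  nlinarith

/-! ### Derandomized rounding to integer vectors -/

/-- Rounding `v ≥ 0` up with probability equal to its fractional part `p` preserves `z` and `|z|` in
mean and has variance `p(1 - p) ≤ v`. The inequality holds on average, hence for one of the two
outcomes. -/
theorem exists_int_rounding (α β γ v : ℝ) (hγ : 0 ≤ γ) :
    ∃ z : ℤ, α * |(z : ℝ)| + β * (z - v) + γ * (z - v) ^ 2 ≤ α * |v| + γ * |v| := by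
  have key : ∀ β v : ℝ, 0 ≤ v →
      ∃ z : ℤ, α * |(z : ℝ)| + β * (z - v) + γ * (z - v) ^ 2 ≤ α * |v| + γ * |v| := by
    intro β v hv
    have hf0 : (0 : ℝ) ≤ ⌊v⌋ := by exact_mod_cast Int.floor_nonneg.2 hv
    set f : ℝ := (⌊v⌋ : ℝ) with hf
    have h1 : f ≤ v := Int.floor_le v
    have h2 : v < f + 1 := Int.lt_floor_add_one v
    by_contra! h
    have ha := h ⌊v⌋
    have hb := h (⌊v⌋ + 1)
    push_cast at ha hb
    rw [← hf, abs_of_nonneg hf0, abs_of_nonneg hv] at ha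
    rw [← hf, abs_of_nonneg (by linarith : (0 : ℝ) ≤ f + 1), abs_of_nonneg hv] at hb
    have hc := mul_lt_mul_of_pos_left ha (by linarith : 0 < 1 - (v - f))
    have hd := mul_le_mul_of_nonneg_left hb.le (by linarith : 0 ≤ v - f)
    have he : γ * ((v - f) * (1 - (v - f))) ≤ γ * v :=
      mul_le_mul_of_nonneg_left (by nlinarith) hγ
    nlinarith
  rcases le_total 0 v with hv | hv
  · exact key β v hv
  · obtain ⟨z, hz⟩ := key (-β) (-v) (by linarith)
    refine ⟨-z, ?_⟩
    push_cast
    rw [abs_neg] at hz ⊢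
    nlinarith

/-- Method of conditional expectations: coordinates are rounded one at a time, and the cross term
with the accumulated error `e` is the linear term `β` of the scalar lemma. -/
theorem exists_int_vec_rounding {m n : ℕ} (A : Matrix (Fin m) (Fin n) ℝ) (α : ℝ)
    (hA : ∀ i j, |A i j| ≤ 1) (v : Fin m → ℝ) :
    ∃ z : Fin m → ℤ, α * ∑ i, |(z i : ℝ)| + ∑ j, (∑ i, (z i - v i) * A i j) ^ 2
      ≤ (α + n) * ∑ i, |v i| := by
  have key : ∀ s : Finset (Fin m), ∃ z : Fin m → ℤ,
      α * ∑ i ∈ s, |(z i : ℝ)| + ∑ j, (∑ i ∈ s, (z i - v i) * A i j) ^ 2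
      ≤ (α + n) * ∑ i ∈ s, |v i| := by
    intro s
    induction s using Finset.induction_on with
    | empty => exact ⟨0, by simp⟩
    | insert a s ha ih =>
      obtain ⟨z, hz⟩ := ih
      set e : Fin n → ℝ := fun j => ∑ i ∈ s, (z i - v i) * A i j with he
      obtain ⟨x, hx⟩ := exists_int_rounding α (2 * ∑ j, e j * A a j) (∑ j, (A a j) ^ 2) (v a)
        (by positivity)
      refine ⟨Function.update z a x, ?_⟩
      have hne : ∀ i ∈ s, Function.update z a x i = z i := fun i hi =>
        Function.update_of_ne (ne_of_mem_of_not_mem hi ha) _ _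
      have e1 : ∑ i ∈ s, |((Function.update z a x i : ℤ) : ℝ)| = ∑ i ∈ s, |(z i : ℝ)| :=
        Finset.sum_congr rfl fun i hi => by rw [hne i hi]
      have e2 : ∀ j, ∑ i ∈ s, (((Function.update z a x i : ℤ) : ℝ) - v i) * A i j = e j :=
        fun j => Finset.sum_congr rfl fun i hi => by rw [hne i hi]
      simp only [Finset.sum_insert ha, Function.update_self, e1, e2]
      have e3 : ∑ j, (((x : ℝ) - v a) * A a j + e j) ^ 2
          = (2 * ∑ j, e j * A a j) * (x - v a) + (∑ j, (A a j) ^ 2) * (x - v a) ^ 2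
            + ∑ j, e j ^ 2 := by
        simp only [Finset.mul_sum, Finset.sum_mul, ← Finset.sum_add_distrib]
        exact Finset.sum_congr rfl fun j _ => by ring
      have e4 : ∑ j, (A a j) ^ 2 ≤ n := by
        calc ∑ j, (A a j) ^ 2 ≤ ∑ _j : Fin n, (1 : ℝ) :=
              Finset.sum_le_sum fun j _ => (sq_le_one_iff_abs_le_one _).2 (hA a j)
          _ = n := by simp
      have e5 := mul_le_mul_of_nonneg_right e4 (abs_nonneg (v a))
      rw [e3]
      nlinarith
  exact key Finset.univ

/-- A dual solution `u` can be replaced by an integer multiple of `η = δ R / n`, at the cost of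
half of the penalty and of `δ n / 2`. -/
theorem exists_int_dual_le {m n : ℕ} (hn : n ≠ 0) (A : Matrix (Fin m) (Fin n) ℝ)
    (hA : ∀ i j, |A i j| ≤ 1) {R δ : ℝ} (hR : 0 < R) (hδ : 0 < δ) (g : Fin n → ℝ)
    (u : Fin m → ℝ) :
    ∃ z : Fin m → ℤ,
      ∑ j, |g j - Matrix.vecMul (fun i => δ * R / n * z i) A j|
          + δ * R ^ 2 / (2 * n) * ∑ i, |(z i : ℝ)|
        ≤ ∑ j, |g j - Matrix.vecMul u A j| + R * ∑ i, |u i| + δ * n / 2 := by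
  have hn' : (0 : ℝ) < n := by exact_mod_cast Nat.pos_of_ne_zero hn
  set η : ℝ := δ * R / n with hη
  have hη0 : 0 < η := by positivity
  -- The choice `α = n` splits the budget `2n‖u/η‖₁` equally; after scaling by `η² / (2δ)` it is
  -- exactly `R‖u‖₁`.
  obtain ⟨z, hz⟩ := exists_int_vec_rounding A n hA (fun i => u i / η)
  refine ⟨z, ?_⟩
  set e : Fin n → ℝ := fun j => ∑ i, (z i - u i / η) * A i j with he
  have e1 : ∀ j, Matrix.vecMul (fun i => η * z i) A j = Matrix.vecMul u A j + η * e j := by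
    intro j
    simp only [Matrix.vecMul, dotProduct, he, Finset.mul_sum, ← Finset.sum_add_distrib]
    refine Finset.sum_congr rfl fun i _ => ?_
    field_simp
    ring
  have e2 : ∀ j, |g j - Matrix.vecMul (fun i => η * z i) A j|
      ≤ |g j - Matrix.vecMul u A j| + (δ / 2 + η ^ 2 / (2 * δ) * e j ^ 2) := by
    intro j
    have h1 : |η * e j| ≤ δ / 2 + η ^ 2 / (2 * δ) * e j ^ 2 := by
      have h2 : 0 ≤ (|η * e j| - δ) ^ 2 / (2 * δ) := by positivity
      have h3 : (|η * e j| - δ) ^ 2 / (2 * δ)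
          = η ^ 2 / (2 * δ) * e j ^ 2 + δ / 2 - |η * e j| := by
        have : |η * e j| ^ 2 = η ^ 2 * e j ^ 2 := by rw [sq_abs]; ring
        rw [sub_sq, this]
        field_simp
        ring
      linarith
    rw [e1]
    calc |g j - (Matrix.vecMul u A j + η * e j)|
        = |(g j - Matrix.vecMul u A j) - η * e j| := by ring_nf
      _ ≤ |g j - Matrix.vecMul u A j| + |η * e j| := abs_sub _ _
      _ ≤ _ := by linarith
  have e3 := Finset.sum_le_sum fun j (_ : j ∈ Finset.univ) => e2 j
  simp only [Finset.sum_add_distrib, ← Finset.mul_sum, Finset.sum_const, Finset.card_univ,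
    Fintype.card_fin, nsmul_eq_mul] at e3
  have e4 : ∑ i, |u i / η| = (∑ i, |u i|) / η := by
    rw [Finset.sum_div]
    exact Finset.sum_congr rfl fun i _ => by rw [abs_div, abs_of_pos hη0]
  rw [e4] at hz
  have e5 := mul_le_mul_of_nonneg_left hz (by positivity : 0 ≤ η ^ 2 / (2 * δ))
  have e6 : η ^ 2 / (2 * δ) * (((n : ℝ) + n) * ((∑ i, |u i|) / η)) = R * ∑ i, |u i| := by
    rw [hη]; field_simp; ring
  have e7 : η ^ 2 / (2 * δ) * (n * ∑ i, |(z i : ℝ)|)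
      = δ * R ^ 2 / (2 * n) * ∑ i, |(z i : ℝ)| := by
    rw [hη]; field_simp
  rw [mul_add, e7, e6] at e5
  linarith

/-! ### Exponential moments -/

/-- Pairing `w` with `-w` cancels the first-order effect of the shift. For `0 ≤ w ≤ a` the left side
is `2 cosh(lw)`; for larger `w` the bound holds termwise. -/
theorem exp_abs_sub_add_exp_le {l : ℝ} (hl : 0 ≤ l) (a w : ℝ) :
    Real.exp (l * (|a| - |a - w|)) + Real.exp (l * (|a| - |a + w|))
      ≤ Real.exp (l * a) + Real.exp (-(l * a)) := by
  have key : ∀ b v : ℝ, 0 ≤ b → 0 ≤ v →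
      Real.exp (l * (b - |b - v|)) + Real.exp (l * (b - |b + v|))
      ≤ Real.exp (l * b) + Real.exp (-(l * b)) := by
    intro b v hb hv
    rw [abs_of_nonneg (by linarith : 0 ≤ b + v)]
    rcases le_total v b with h | h
    · rw [abs_of_nonneg (by linarith : 0 ≤ b - v)]
      have hc : Real.cosh (l * v) ≤ Real.cosh (l * b) := by
        rw [Real.cosh_le_cosh, abs_of_nonneg (by positivity), abs_of_nonneg (by positivity)]
        exact mul_le_mul_of_nonneg_left h hl
      rw [Real.cosh_eq, Real.cosh_eq] at hc
      have e1 : l * (b - (b - v)) = l * v := by ring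
      have e2 : l * (b - (b + v)) = -(l * v) := by ring
      rw [e1, e2]
      linarith
    · rw [abs_of_nonpos (by linarith : b - v ≤ 0)]
      refine add_le_add (Real.exp_le_exp.2 ?_) (Real.exp_le_exp.2 ?_)
      · exact mul_le_mul_of_nonneg_left (by linarith) hl
      · nlinarith
  rcases le_total 0 a with ha | ha <;> rcases le_total 0 w with hw | hw
  · simpa only [abs_of_nonneg ha] using key a w ha hw
  · have := key a (-w) ha (by linarith)
    rw [abs_of_nonneg ha]
    rw [sub_neg_eq_add, ← sub_eq_add_neg] at this
    linarith
  · have := key (-a) w (by linarith) hw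
    rw [abs_of_nonpos ha]
    rw [show -a - w = -(a + w) by ring, show -a + w = -(a - w) by ring, abs_neg, abs_neg,
      show l * -a = -(l * a) by ring, neg_neg] at this
    linarith
  · have := key (-a) (-w) (by linarith) (by linarith)
    rw [abs_of_nonpos ha]
    rw [show -a - -w = -(a - w) by ring, show -a + -w = -(a + w) by ring, abs_neg, abs_neg,
      show l * -a = -(l * a) by ring, neg_neg] at this
    linarith

theorem integrable_exp_abs_sub (l w : ℝ) :
    Integrable (fun x : ℝ => Real.exp (l * (|x| - |x - w|))) (gaussianReal 0 1) := by
  refine Integrable.of_bound (C := Real.exp (|l| * |w|)) (by fun_prop) (.of_forall fun x => ?_)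
  rw [Real.norm_eq_abs, Real.abs_exp, Real.exp_le_exp]
  calc l * (|x| - |x - w|) ≤ |l * (|x| - |x - w|)| := le_abs_self _
    _ = |l| * |(|x| - |x - w|)| := abs_mul _ _
    _ ≤ |l| * |w| := by
      refine mul_le_mul_of_nonneg_left ?_ (abs_nonneg _)
      simpa using abs_abs_sub_abs_le_abs_sub x (x - w)

/-- By symmetry of the Gaussian, `w` and `-w` give the same integral, so the paired bound applies to
each; its right side integrates to `2 exp(l²/2)`. -/
theorem integral_exp_abs_sub_le {l : ℝ} (hl : 0 ≤ l) (w : ℝ) :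
    ∫ x, Real.exp (l * (|x| - |x - w|)) ∂(gaussianReal 0 1) ≤ Real.exp (l ^ 2 / 2) := by
  have hsym : ∫ x, Real.exp (l * (|x| - |x + w|)) ∂(gaussianReal 0 1)
      = ∫ x, Real.exp (l * (|x| - |x - w|)) ∂(gaussianReal 0 1) := by
    have h := gaussianReal_map_neg (μ := 0) (v := 1)
    rw [neg_zero] at h
    conv_rhs => rw [← h]
    rw [integral_map (by fun_prop) (by fun_prop)]
    refine integral_congr_ae (.of_forall fun x => ?_)
    simp only [abs_neg]
    rw [show -x - w = -(x + w) by ring, abs_neg]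
  have hm : ∀ t : ℝ, ∫ x, Real.exp (t * x) ∂(gaussianReal 0 1) = Real.exp (t ^ 2 / 2) := by
    intro t
    have := mgf_gaussianReal (p := gaussianReal 0 1) (X := id) (μ := 0) (v := 1) (by simp) t
    simpa [mgf] using this
  have hle := integral_mono
    ((integrable_exp_abs_sub l w).add (by simpa using integrable_exp_abs_sub l (-w)))
    ((integrable_exp_mul_gaussianReal (μ := 0) (v := 1) l).add
      (integrable_exp_mul_gaussianReal (μ := 0) (v := 1) (-l)))
    (fun x => by simpa using exp_abs_sub_add_exp_le hl x w)
  simp only [Pi.add_apply] at hle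
  rw [integral_add (integrable_exp_abs_sub l w) (by simpa using integrable_exp_abs_sub l (-w)),
    integral_add (integrable_exp_mul_gaussianReal l) (integrable_exp_mul_gaussianReal (-l)),
    hm, hm, hsym, neg_sq] at hle
  linarith

theorem lintegral_exp_sum_abs_sub_le {n : ℕ} {l : ℝ} (hl : 0 ≤ l) (w : Fin n → ℝ) :
    ∫⁻ g, ENNReal.ofReal (Real.exp (l * (∑ j, |g j| - ∑ j, |g j - w j|))) ∂(stdNormal n)
      ≤ ENNReal.ofReal (Real.exp (n * (l ^ 2 / 2))) := by
  have e : ∀ g : Fin n → ℝ, Real.exp (l * (∑ j, |g j| - ∑ j, |g j - w j|))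
      = ∏ j, Real.exp (l * (|g j| - |g j - w j|)) := by
    intro g
    rw [← Real.exp_sum, ← Finset.sum_sub_distrib, Finset.mul_sum]
  simp only [e]
  unfold stdNormal
  rw [← ofReal_integral_eq_lintegral_ofReal
    (Integrable.fintype_prod fun j => integrable_exp_abs_sub l (w j))
    (.of_forall fun g => by positivity)]
  refine ENNReal.ofReal_le_ofReal ?_
  rw [integral_fintype_prod_eq_prod (fun j x => Real.exp (l * (|x| - |x - w j|)))]
  calc ∏ j, ∫ x, Real.exp (l * (|x| - |x - w j|)) ∂(gaussianReal 0 1)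
      ≤ ∏ _j : Fin n, Real.exp (l ^ 2 / 2) :=
        Finset.prod_le_prod (fun j _ => integral_nonneg fun x => (Real.exp_pos _).le)
          fun j _ => integral_exp_abs_sub_le hl (w j)
    _ = Real.exp (n * (l ^ 2 / 2)) := by
        rw [Finset.prod_const, Finset.card_univ, Fintype.card_fin, ← Real.exp_nat_mul]

/-! ### The weighted count of integer vectors -/

theorem sum_pow_natAbs_le {q : ℝ} (hq : 0 ≤ q) (hq2 : q ≤ 1 / 2) (s : Finset ℤ) :
    ∑ z ∈ s, q ^ z.natAbs ≤ 1 + 4 * q := by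
  have hg := summable_geometric_of_lt_one hq (by linarith)
  have hgeo : ∑' k : ℕ, q ^ k ≤ 1 + 2 * q := by
    rw [tsum_geometric_of_lt_one hq (by linarith), inv_le_iff_one_le_mul₀ (by linarith)]
    nlinarith
  have h1 : HasSum (fun k : ℕ => q ^ (k : ℤ).natAbs) (∑' k : ℕ, q ^ k) := by
    simpa using hg.hasSum
  have h2 : HasSum (fun k : ℕ => q ^ (-((k : ℤ) + 1)).natAbs) (q * ∑' k : ℕ, q ^ k) := by
    have e : ∀ k : ℕ, q ^ (-((k : ℤ) + 1)).natAbs = q * q ^ k := by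
      intro k
      rw [Int.natAbs_neg, show ((k : ℤ) + 1).natAbs = k + 1 by omega, pow_succ']
    simp only [e]
    exact hg.hasSum.mul_left q
  have h3 := HasSum.of_nat_of_neg_add_one (f := fun z : ℤ => q ^ z.natAbs) h1 (by simpa using h2)
  refine (sum_le_hasSum s (fun z _ => by positivity) h3).trans ?_
  nlinarith

/-- A finite set of integer vectors lies in a box, over which the sum factors into `m` geometric
sums. -/
theorem tsum_pow_natAbs_le {m : ℕ} {q : ℝ} (hq : 0 ≤ q) (hq2 : q ≤ 1 / 2) :
    ∑' z : Fin m → ℤ, ENNReal.ofReal (∏ i, q ^ (z i).natAbs)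
      ≤ ENNReal.ofReal (Real.exp (4 * m * q)) := by
  rw [ENNReal.tsum_eq_iSup_sum]
  refine iSup_le fun s => ?_
  rw [← ENNReal.ofReal_sum_of_nonneg fun z _ => by positivity]
  refine ENNReal.ofReal_le_ofReal ?_
  let t : Fin m → Finset ℤ := fun i => s.image fun z => z i
  have hst : s ⊆ Fintype.piFinset t := fun z hz =>
    Fintype.mem_piFinset.2 fun i => Finset.mem_image_of_mem _ hz
  calc ∑ z ∈ s, ∏ i, q ^ (z i).natAbs
      ≤ ∑ z ∈ Fintype.piFinset t, ∏ i, q ^ (z i).natAbs :=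
        Finset.sum_le_sum_of_subset_of_nonneg hst fun z _ _ => by positivity
    _ = ∏ i, ∑ k ∈ t i, q ^ k.natAbs := (Finset.prod_univ_sum t fun _ k => q ^ k.natAbs).symm
    _ ≤ ∏ _i : Fin m, Real.exp (4 * q) :=
        Finset.prod_le_prod (fun i _ => Finset.sum_nonneg fun k _ => by positivity) fun i _ =>
          (sum_pow_natAbs_le hq hq2 _).trans (by linarith [Real.add_one_le_exp (4 * q)])
    _ = Real.exp (4 * m * q) := by
        rw [Finset.prod_const, Finset.card_univ, Fintype.card_fin, ← Real.exp_nat_mul]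
        ring_nf

/-! ### The gap between the polytope and the cube -/

theorem integrable_sum_abs (n : ℕ) :
    Integrable (fun g : Fin n → ℝ => ∑ j, |g j|) (stdNormal n) := by
  refine integrable_finsetSum _ fun j _ => ?_
  have h0 : Integrable (fun x : ℝ => |x|) (gaussianReal 0 1) :=
    ((memLp_id_gaussianReal (μ := 0) (v := 1) 1).integrable le_rfl).abs
  exact integrable_comp_eval (μ := fun _ : Fin n => gaussianReal 0 1) (i := j) h0

instance isProbabilityMeasure_stdNormal (n : ℕ) : IsProbabilityMeasure (stdNormal n) := by
  unfold stdNormal; infer_instance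

/-- Jensen's inequality via `1 + x ≤ exp x` at `x = f - B`. The lower integral spares any
integrability of `exp ∘ f`. -/
theorem integral_le_of_lintegral_exp_le {Ω : Type*} [MeasurableSpace Ω] {μ : Measure Ω}
    [IsProbabilityMeasure μ] {f : Ω → ℝ} (hf : Integrable f μ) {B : ℝ}
    (h : ∫⁻ x, ENNReal.ofReal (Real.exp (f x)) ∂μ ≤ ENNReal.ofReal (Real.exp B)) :
    ∫ x, f x ∂μ ≤ B := by
  have h1 : ∫⁻ x, ENNReal.ofReal (f x - B + 1) ∂μ ≤ 1 := by
    calc ∫⁻ x, ENNReal.ofReal (f x - B + 1) ∂μ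
        ≤ ∫⁻ x, ENNReal.ofReal (Real.exp (-B)) * ENNReal.ofReal (Real.exp (f x)) ∂μ := by
          refine lintegral_mono fun x => ?_
          rw [← ENNReal.ofReal_mul (Real.exp_pos _).le, ← Real.exp_add]
          refine ENNReal.ofReal_le_ofReal ?_
          have := Real.add_one_le_exp (-B + f x)
          linarith
      _ = ENNReal.ofReal (Real.exp (-B)) * ∫⁻ x, ENNReal.ofReal (Real.exp (f x)) ∂μ :=
          lintegral_const_mul' _ _ ENNReal.ofReal_ne_top
      _ ≤ ENNReal.ofReal (Real.exp (-B)) * ENNReal.ofReal (Real.exp B) := by gcongr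
      _ = 1 := by
          rw [← ENNReal.ofReal_mul (Real.exp_pos _).le, ← Real.exp_add]
          simp
  have hint : Integrable (fun x => f x - B + 1) μ :=
    (hf.sub (integrable_const B)).add (integrable_const 1)
  have h2 : ∫ x, (f x - B + 1) ∂μ ≤ 1 := by
    rw [integral_eq_lintegral_pos_part_sub_lintegral_neg_part hint]
    have h3 := ENNReal.toReal_mono ENNReal.one_ne_top h1
    rw [ENNReal.toReal_one] at h3
    have h4 : 0 ≤ (∫⁻ x, ENNReal.ofReal (-(f x - B + 1)) ∂μ).toReal := ENNReal.toReal_nonneg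
    linarith
  rw [integral_add (f := fun x => f x - B) (hf.sub (integrable_const B)) (integrable_const 1),
    integral_sub hf (integrable_const B)] at h2
  simp only [integral_const, probReal_univ, smul_eq_mul, one_mul] at h2
  linarith

/-- With `r = m/n + 2`, the exponent of `1/r` is at least `1 + 11/δ²`. One factor `1/r` absorbs `m`,
since `m/r ≤ n`; the remainder is at most `δ²/4` because `log r ≥ 1/2`. -/
theorem exp_neg_mul_log_bounds {m n : ℕ} (hn : n ≠ 0) {δ C : ℝ} (hδ : 0 < δ) (hδ1 : δ ≤ 1)
    (hC : 5 / δ ^ 2 ≤ C) :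
    Real.exp (-(δ ^ 2 * C ^ 2 / 2 * Real.log ((m : ℝ) / n + 2))) ≤ 1 / 2 ∧
    4 * m * Real.exp (-(δ ^ 2 * C ^ 2 / 2 * Real.log ((m : ℝ) / n + 2))) ≤ n * δ ^ 2 := by
  have hn' : (0 : ℝ) < n := by exact_mod_cast Nat.pos_of_ne_zero hn
  have hr : (2 : ℝ) ≤ (m : ℝ) / n + 2 := by
    have : (0 : ℝ) ≤ (m : ℝ) / n := by positivity
    linarith
  set r : ℝ := (m : ℝ) / n + 2 with hrdef
  have hr0 : 0 < r := by linarith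
  have hL : 1 / 2 ≤ Real.log r := by
    have h1 := Real.log_le_log two_pos hr
    have h2 := Real.log_two_gt_d9
    linarith
  have hδ2 : 0 < δ ^ 2 := by positivity
  have hδ21 : δ ^ 2 ≤ 1 := pow_le_one₀ hδ.le hδ1
  have hE : 1 + 11 / δ ^ 2 ≤ δ ^ 2 * C ^ 2 / 2 := by
    have h1 : (5 / δ ^ 2) ^ 2 ≤ C ^ 2 := by gcongr
    have h2 : δ ^ 2 * (5 / δ ^ 2) ^ 2 / 2 ≤ δ ^ 2 * C ^ 2 / 2 := by gcongr
    have h3 : δ ^ 2 * (5 / δ ^ 2) ^ 2 / 2 = 11 / δ ^ 2 + (3 / 2) * (1 / δ ^ 2) := by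
      field_simp; norm_num
    have h4 : 1 ≤ 1 / δ ^ 2 := by rw [le_div_iff₀ hδ2]; linarith
    linarith
  have hq : Real.exp (-(δ ^ 2 * C ^ 2 / 2 * Real.log r)) ≤ r⁻¹ * (δ ^ 2 / 4) := by
    have h1 : Real.exp (-(δ ^ 2 * C ^ 2 / 2 * Real.log r))
        ≤ Real.exp (-Real.log r + -(11 / δ ^ 2 * (1 / 2))) := by
      refine Real.exp_le_exp.2 ?_
      have h2 := mul_le_mul_of_nonneg_right hE (by linarith : 0 ≤ Real.log r)
      have h3 : 11 / δ ^ 2 * (1 / 2) ≤ 11 / δ ^ 2 * Real.log r := by gcongr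
      linarith
    refine h1.trans ?_
    rw [Real.exp_add, Real.exp_neg, Real.exp_log hr0]
    refine mul_le_mul_of_nonneg_left ?_ (by positivity)
    rw [Real.exp_neg, inv_le_comm₀ (Real.exp_pos _) (by positivity)]
    have h4 := Real.add_one_le_exp (11 / δ ^ 2 * (1 / 2))
    have h5 : (δ ^ 2 / 4)⁻¹ = 4 / δ ^ 2 := by rw [inv_div]
    have h6 : 11 / δ ^ 2 * (1 / 2) = 4 / δ ^ 2 + (3 / 2) / δ ^ 2 := by ring
    have h7 : 0 ≤ (3 / 2) / δ ^ 2 := by positivity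
    linarith
  have hri : r⁻¹ ≤ 1 / 2 := by
    rw [inv_le_comm₀ hr0 (by norm_num)]; norm_num; exact hr
  refine ⟨hq.trans ?_, ?_⟩
  · have : r⁻¹ * (δ ^ 2 / 4) ≤ (1 / 2) * (1 / 4) := by gcongr
    linarith
  · have h1 : (m : ℝ) * r⁻¹ ≤ n := by
      rw [← div_eq_mul_inv, div_le_iff₀ hr0, hrdef, mul_add, mul_div_cancel₀ _ hn'.ne']
      linarith
    calc 4 * m * Real.exp (-(δ ^ 2 * C ^ 2 / 2 * Real.log r))
        ≤ 4 * m * (r⁻¹ * (δ ^ 2 / 4)) := by gcongr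
      _ = (m * r⁻¹) * δ ^ 2 := by ring
      _ ≤ n * δ ^ 2 := by gcongr

/-- The optimum over `Γ_{A,C}` is within `3 δ n` of the optimum over the whole cube, in
expectation. -/
theorem integral_sum_abs_sub_lpValue_le {m n : ℕ} (hn : n ≠ 0) (A : Matrix (Fin m) (Fin n) ℝ)
    (hA : ∀ i j, |A i j| ≤ 1) {δ C : ℝ} (hδ : 0 < δ) (hδ1 : δ ≤ 1) (hC : 5 / δ ^ 2 ≤ C) :
    ∫ g, ∑ j, |g j| ∂(stdNormal n) - ∫ g, lpValue A C g ∂(stdNormal n) ≤ 3 * δ * n := by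
  have hn' : (0 : ℝ) < n := by exact_mod_cast Nat.pos_of_ne_zero hn
  have hC0 : 0 < C := lt_of_lt_of_le (by positivity) hC
  obtain ⟨hq2, hmq⟩ := exp_neg_mul_log_bounds (m := m) hn hδ hδ1 hC
  set L : ℝ := Real.log ((m : ℝ) / n + 2) with hL
  have hL0 : 0 < L := Real.log_pos (by
    have : (0 : ℝ) ≤ (m : ℝ) / n := by positivity
    linarith)
  set R : ℝ := C * √((n : ℝ) * L) with hR
  have hR0 : 0 < R := by positivity
  have hR2 : R ^ 2 = C ^ 2 * (n * L) := by rw [hR, mul_pow, Real.sq_sqrt (by positivity)]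
  set c : ℝ := δ ^ 2 * C ^ 2 / 2 * L with hc
  set q : ℝ := Real.exp (-c) with hq
  have hq0 : 0 ≤ q := (Real.exp_pos _).le
  let W : (Fin m → ℤ) → Fin n → ℝ := fun z => Matrix.vecMul (fun i => δ * R / n * z i) A
  -- The sum dominates its term at the rounded dual solution. The loss `3/2 δn` is `δn` from
  -- near-optimality plus `δn/2` from rounding.
  have hpt : ∀ g : Fin n → ℝ,
      ENNReal.ofReal (Real.exp (δ * (∑ j, |g j| - lpValue A C g - 3 / 2 * (δ * n))))
      ≤ ∑' z : Fin m → ℤ, ENNReal.ofReal (∏ i, q ^ (z i).natAbs) *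
        ENNReal.ofReal (Real.exp (δ * (∑ j, |g j| - ∑ j, |g j - W z j|))) := by
    intro g
    obtain ⟨u, hu⟩ := exists_dual_le A hC0.le g
      (show lpValue A C g < lpValue A C g + δ * n by linarith [mul_pos hδ hn'])
    obtain ⟨z, hz⟩ := exists_int_dual_le hn A hA hR0 hδ g u
    refine le_trans ?_ (ENNReal.le_tsum z)
    have hprod : ∏ i, q ^ (z i).natAbs = Real.exp (-(c * ∑ i, |(z i : ℝ)|)) := by
      have : ∀ i, q ^ (z i).natAbs = Real.exp (-(c * |(z i : ℝ)|)) := by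
        intro i
        rw [hq, ← Real.exp_nat_mul, Nat.cast_natAbs, Int.cast_abs]
        ring_nf
      simp only [this]
      rw [← Real.exp_sum, Finset.mul_sum, Finset.sum_neg_distrib]
    rw [hprod, ← ENNReal.ofReal_mul (Real.exp_pos _).le, ← Real.exp_add]
    refine ENNReal.ofReal_le_ofReal (Real.exp_le_exp.2 ?_)
    have h1 := mul_le_mul_of_nonneg_left (hz.trans (add_le_add_left hu _)) hδ.le
    have h2 : δ * (δ * R ^ 2 / (2 * n)) = c := by
      rw [hR2, hc]; field_simp
    rw [mul_add, ← mul_assoc δ (δ * R ^ 2 / (2 * n)), h2] at h1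
    linarith
  have hmeas : ∀ z : Fin m → ℤ, Measurable fun g : Fin n → ℝ =>
      ENNReal.ofReal (Real.exp (δ * (∑ j, |g j| - ∑ j, |g j - W z j|))) := by
    intro z; fun_prop
  have hlin : ∫⁻ g, ENNReal.ofReal
        (Real.exp (δ * (∑ j, |g j| - lpValue A C g - 3 / 2 * (δ * n)))) ∂(stdNormal n)
      ≤ ENNReal.ofReal (Real.exp (4 * m * q + n * (δ ^ 2 / 2))) := by
    calc _ ≤ ∫⁻ g, ∑' z : Fin m → ℤ, ENNReal.ofReal (∏ i, q ^ (z i).natAbs) *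
          ENNReal.ofReal (Real.exp (δ * (∑ j, |g j| - ∑ j, |g j - W z j|))) ∂(stdNormal n) :=
          lintegral_mono hpt
      _ = ∑' z : Fin m → ℤ, ENNReal.ofReal (∏ i, q ^ (z i).natAbs) * ∫⁻ g,
          ENNReal.ofReal (Real.exp (δ * (∑ j, |g j| - ∑ j, |g j - W z j|))) ∂(stdNormal n) := by
          rw [lintegral_tsum fun z => ((hmeas z).const_mul _).aemeasurable]
          simp only [lintegral_const_mul _ (hmeas _)]
      _ ≤ ∑' z : Fin m → ℤ, ENNReal.ofReal (∏ i, q ^ (z i).natAbs) *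
          ENNReal.ofReal (Real.exp (n * (δ ^ 2 / 2))) :=
          ENNReal.tsum_le_tsum fun z => by
            gcongr
            exact lintegral_exp_sum_abs_sub_le hδ.le (W z)
      _ ≤ ENNReal.ofReal (Real.exp (4 * m * q)) * ENNReal.ofReal (Real.exp (n * (δ ^ 2 / 2))) := by
          rw [ENNReal.tsum_mul_right]
          gcongr
          exact tsum_pow_natAbs_le hq0 hq2
      _ = _ := by rw [← ENNReal.ofReal_mul (Real.exp_pos _).le, ← Real.exp_add]
  have hi1 := integrable_sum_abs n
  have hi2 := integrable_lpValue A hC0.le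
  have hfin := integral_le_of_lintegral_exp_le
    (((hi1.sub hi2).sub (integrable_const (3 / 2 * (δ * n)))).const_mul δ) hlin
  simp only [Pi.sub_apply] at hfin
  rw [integral_const_mul, integral_sub (f := fun g => ∑ j, |g j| - lpValue A C g) (hi1.sub hi2)
    (integrable_const _), integral_sub hi1 hi2] at hfin
  simp only [integral_const, probReal_univ, smul_eq_mul, one_mul] at hfin
  refine le_of_mul_le_mul_left ?_ hδ
  nlinarith

/-! ### Concavity in `C` -/

theorem concaveOn_lpValue {m n : ℕ} (A : Matrix (Fin m) (Fin n) ℝ) (g : Fin n → ℝ) :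
    ConcaveOn ℝ (Set.Ici 0) fun C => lpValue A C g := by
  refine ⟨convex_Ici 0, fun C hC D hD a b ha hb hab => ?_⟩
  rw [Set.mem_Ici] at hC hD
  obtain ⟨y, hy, hyg⟩ := (isGreatest_lpValue A hC g).1
  obtain ⟨z, hz, hzg⟩ := (isGreatest_lpValue A hD g).1
  simp only [smul_eq_mul] at *
  rw [← hyg, ← hzg]
  refine (isGreatest_lpValue A (by positivity) g).2 ⟨a • y + b • z, ⟨?_, ?_⟩, ?_⟩
  · rw [Matrix.mulVec_add, Matrix.mulVec_smul, Matrix.mulVec_smul]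
    refine (norm_add_le _ _).trans ?_
    rw [norm_smul, norm_smul, Real.norm_of_nonneg ha, Real.norm_of_nonneg hb, add_mul, mul_assoc,
      mul_assoc]
    exact add_le_add (mul_le_mul_of_nonneg_left hy.1 ha) (mul_le_mul_of_nonneg_left hz.1 hb)
  · refine (norm_add_le _ _).trans ?_
    rw [norm_smul, norm_smul, Real.norm_of_nonneg ha, Real.norm_of_nonneg hb]
    nlinarith [hy.2, hz.2]
  · simp only [dotProduct_add, dotProduct_smul, smul_eq_mul]

theorem concaveOn_OPT {m n : ℕ} (A : Matrix (Fin m) (Fin n) ℝ) :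
    ConcaveOn ℝ (Set.Ici 0) (OPT A) := by
  refine ⟨convex_Ici 0, fun C hC D hD a b ha hb hab => ?_⟩
  have hCD := (convex_Ici (0 : ℝ)) hC hD ha hb hab
  rw [Set.mem_Ici] at hC hD hCD
  have h := integral_mono
    (((integrable_lpValue A hC).const_mul a).add ((integrable_lpValue A hD).const_mul b))
    (integrable_lpValue A hCD) fun g => (concaveOn_lpValue A g).2 hC hD ha hb hab
  simp only [Pi.add_apply] at h
  rw [integral_add ((integrable_lpValue A hC).const_mul a) ((integrable_lpValue A hD).const_mul b),
    integral_const_mul, integral_const_mul] at h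
  unfold OPT
  simp only [smul_eq_mul] at h ⊢
  rw [← mul_div_assoc, ← mul_div_assoc, ← add_div]
  gcongr

theorem OPT_le {m n : ℕ} (A : Matrix (Fin m) (Fin n) ℝ) {C : ℝ} (hC : 0 ≤ C) :
    OPT A C ≤ (∫ g, ∑ j, |g j| ∂(stdNormal n)) / √(n : ℝ) := by
  unfold OPT
  refine div_le_div_of_nonneg_right
    (integral_mono (integrable_lpValue A hC) (integrable_sum_abs n) fun g => ?_) (by positivity)
  obtain ⟨y, hy, hyg⟩ := (isGreatest_lpValue A hC g).1
  rw [← hyg]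
  exact dotProduct_le_of_norm_le_one g y hy.2

theorem OPT_add_sub_le {m n : ℕ} (A : Matrix (Fin m) (Fin n) ℝ) (hA : ∀ i j, |A i j| ≤ 1)
    {δ ε C C' : ℝ} (hδ : 0 < δ) (hδ1 : δ ≤ 1) (hε : 0 ≤ ε) (hC : 360 / δ ^ 2 ≤ C)
    (hCC' : C ≤ C') : OPT A (C' + C * ε) - OPT A C' ≤ δ * ε * √(n : ℝ) := by
  rcases eq_or_ne n 0 with rfl | hn
  -- For `n = 0` the division by `√0` makes `OPT` zero.
  · simp [OPT]
  have hn' : (0 : ℝ) < n := by exact_mod_cast Nat.pos_of_ne_zero hn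
  have hC0 : 0 < C := lt_of_lt_of_le (by positivity) hC
  rcases hε.eq_or_lt with rfl | hε
  · simp
  have hC'0 : 0 < C' := hC0.trans_le hCC'
  have hgap : OPT A C' - OPT A (C / 2) ≤ δ / 2 * √(n : ℝ) := by
    have h1 := OPT_le A hC'0.le
    have h2 := integral_sum_abs_sub_lpValue_le hn A hA (δ := δ / 6) (C := C / 2) (by positivity)
      (by linarith) (by
        rw [show 5 / (δ / 6) ^ 2 = 360 / δ ^ 2 / 2 by field_simp; norm_num]
        linarith)
    have h3 : (∫ g, ∑ j, |g j| ∂(stdNormal n)) / √(n : ℝ) - OPT A (C / 2)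
        ≤ 3 * (δ / 6) * n / √(n : ℝ) := by
      unfold OPT
      rw [← sub_div]
      gcongr
    rw [mul_div_assoc, Real.div_sqrt] at h3
    linarith
  have hs := (concaveOn_OPT A).slope_anti_adjacent (x := C / 2) (y := C') (z := C' + C * ε)
    (Set.mem_Ici.2 (by positivity)) (Set.mem_Ici.2 (by positivity)) (by linarith)
    (by linarith [mul_pos hC0 hε])
  rw [add_sub_cancel_left, div_le_iff₀ (by positivity)] at hs
  refine hs.trans ?_
  have h4 : (OPT A C' - OPT A (C / 2)) / (C' - C / 2) ≤ δ / 2 * √(n : ℝ) / (C / 2) :=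
    div_le_div₀ (by positivity) hgap (by positivity) (by linarith)
  calc _ ≤ δ / 2 * √(n : ℝ) / (C / 2) * (C * ε) := by gcongr
    _ = δ * ε * √(n : ℝ) := by field_simp

end SpencerLP

theorem corollary3p5 :
    ∃ c : ℝ, 0 < c ∧ ∃ C₀ : ℝ → ℝ,
      AntitoneOn C₀ (Set.Ioc 0 1) ∧ (∀ δ ∈ Set.Ioc (0 : ℝ) 1, 0 < C₀ δ) ∧
      ∀ (m n : ℕ) (A : Matrix (Fin m) (Fin n) ℝ), SpencerLP.oneToInftyNorm A ≤ 1 →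
        ∀ ε : ℝ, 0 ≤ ε → ε ≤ c → ∀ δ ∈ Set.Ioc (0 : ℝ) 1, ∀ C : ℝ, C₀ δ ≤ C →
          5 / 6 ≤ SpencerLP.unif C (2 * C)
            {C' : ℝ | SpencerLP.OPT A (C' + C * ε) - SpencerLP.OPT A C' ≤ δ * ε * √(n : ℝ)} := by
  -- The value `c = 1` is arbitrary. The gap bound at `C / 2` with `δ / 6` needs `C / 2 ≥ 5 / (δ /
  -- 6)²`, whence 360.
  refine ⟨1, one_pos, fun δ => 360 / δ ^ 2, ?_, fun δ hδ => ?_, ?_⟩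
  · intro a ha b hb hab
    have := ha.1
    dsimp only
    gcongr
  · have := hδ.1
    positivity
  · intro m n A hA ε hε _ δ hδ C hC
    have hC0 : 0 < C := lt_of_lt_of_le (by have := hδ.1; positivity) hC
    have := SpencerLP.isProbabilityMeasure_unif (show C < 2 * C by linarith)
    have h1 : SpencerLP.unif C (2 * C) (Set.Icc C (2 * C)) = 1 := by
      unfold SpencerLP.unif
      exact ProbabilityTheory.cond_apply_self (by simp [hC0]) (by simp)
    calc (5 / 6 : ENNReal) ≤ 1 := ENNReal.div_le_of_le_mul (by norm_num)
      _ = SpencerLP.unif C (2 * C) (Set.Icc C (2 * C)) := h1.symm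
      _ ≤ _ := measure_mono fun C' hC' => SpencerLP.OPT_add_sub_le A
          ((SpencerLP.oneToInftyNorm_le_one_iff A).1 hA) hδ.1 hδ.2 hε hC hC'.1
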